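/- Let $(\Omega,\mu)$ be a totally $\sigma$-finite measure space with a non-atomic measure $\mu$, and let $\mathcal M(\Omega,\mu)$ be the set of all (real- or complex-valued) $\mu$-measurable functions on $\Omega$, functions equal $\mu$-a.e. being identified. For $f\in\mathcal M(\Omega,\mu)$ and $t>0$ put $$f^*(t)=\inf\{\lambda\ge 0:\ \mu(\{|f|>\lambda\})\le t\},\qquad f^{**}(t)=\frac1t\int_0^t f^*(u)\,du .$$ A positive Lebesgue measurable function $b$ on $(0,\infty)$ is called slowly varying, $b\in SV$, if for each $\varepsilon>0$ the function $t^{\varepsilon}b(t)$ is equivalent to a non-decreasing function and $t^{-\varepsilon}b(t)$ is equivalent to a non-increasing function (two functions being equivalent if each is bounded by a constant multiple of the other). Write $\|\cdot\|_{q,(s,t)}$ for the (quasi-)norm of $L_q$ on the interval $(s,t)$ with Lebesgue measure, $L_{1,\infty}$ for the space of all $f\in\mathcal M(\Omega,\mu)$ with $\|f\|_{1,\infty}=\|tf^*(t)\|_{\infty,(0,\infty)}<\infty$, and $$K(t,f;A_0,A_1)=\inf\{\|f_0\|_{A_0}+t\|f_1\|_{A_1}:\ f=f_0+f_1,\ f_i\in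 A_i\}.$$ Let $0<\theta\le1$, $p=\frac1{1-\theta}$ (so $p=\infty$ if $\theta=1$; $1/\infty=0$), $0<q,r\le\infty$ and $a,b\in SV$. For $A_0=L_1$ or $A_0=L_{1,\infty}$ let $(A_0,L_\infty)^{\mathcal R}_{\theta,r,b,q,a}$ be the space of all $f\in A_0+L_\infty$ with $$\Big\|t^{-\frac1r}b(t)\,\big\|u^{-\theta-\frac1q}a(u)K(u,f;A_0,L_\infty)\big\|_{q,(t,\infty)}\Big\|_{r,(0,\infty)}<\infty ,$$ and let $L^{\mathcal R}_{p,r,b,q,a}$ and $(L)^{\mathcal R}_{p,r,b,q,a}$ be the spaces of all $f\in\mathcal M(\Omega,\mu)$ with, respectively, $$\Big\|t^{-\frac1r}b(t)\,\big\|u^{\frac1p-\frac1q}a(u)f^{*}(u)\big\|_{q,(t,\infty)}\Big\|_{r,(0,\infty)}<\infty,\qquad \Big\|t^{-\frac1r}b(t)\,\big\|u^{\frac1p-\frac1q}a(u)f^{**}(u)\big\|_{q,(t,\infty)}\Big\|_{r,(0,\infty)}<\infty ,$$ each space being equipped with the quasi-norm on the left-hand side. The grand Lorentz–Karamata spaces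 $L^{p),q,r}_b$ and $(L)^{p),q,r}_b$ are defined by the last two conditions with $a(u)$ omitted. Then $$(L_1,L_\infty)^{\mathcal R}_{\theta,r,b,q,a}=(L_{1,\infty},L_\infty)^{\mathcal R}_{\theta,r,b,q,a}=(L)^{\mathcal R}_{p,r,b,q,a}=L^{\mathcal R}_{p,r,b,q,a},$$ meaning that the spaces coincide as sets and their quasi-norms are equivalent, i.e. each is bounded on the space by a constant, independent of $f$, times any other. In particular, with $a\equiv1$, $$(L_1,L_\infty)^{\mathcal R}_{\theta,r,b,q,1}=(L_{1,\infty},L_\infty)^{\mathcal R}_{\theta,r,b,q,1}=(L)^{p),q,r}_{b}=L^{p),q,r}_{b}.$$ -/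

import Mathlib

open MeasureTheory Set
open scoped ENNReal NNReal

namespace LorentzKaramata

noncomputable section

/-- `μ` is non-atomic: every measurable set of positive measure has a measurable subset of
strictly smaller positive measure. (Stronger in general than vanishing on singletons.) -/
def IsNonatomic {Ω : Type*} [MeasurableSpace Ω] (μ : Measure Ω) : Prop :=
  ∀ A, MeasurableSet A → 0 < μ A → ∃ B ⊆ A, MeasurableSet B ∧ 0 < μ B ∧ μ B < μ A

/-- `f ≈ g` on `(0, ∞)`: each function is bounded by a positive constant times the other. -/
def EquivOn (f g : ℝ → ℝ) : Prop :=
  ∃ C : ℝ, 0 < C ∧ ∀ t, 0 < t → f t ≤ C * g t ∧ g t ≤ C * f t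

/-- Slowly varying functions on `(0, ∞)`; values outside `(0, ∞)` are irrelevant. -/
structure IsSlowlyVarying (b : ℝ → ℝ) : Prop where
  measurable : AEMeasurable b (volume.restrict (Ioi 0))
  pos : ∀ t, 0 < t → 0 < b t
  equiv_increasing : ∀ ε : ℝ, 0 < ε →
    ∃ g : ℝ → ℝ, MonotoneOn g (Ioi 0) ∧ EquivOn (fun t => t ^ ε * b t) g
  equiv_decreasing : ∀ ε : ℝ, 0 < ε →
    ∃ g : ℝ → ℝ, AntitoneOn g (Ioi 0) ∧ EquivOn (fun t => t ^ (-ε) * b t) g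

/-- The (quasi-)norm of `L_q` on the set `s ⊆ ℝ` with Lebesgue measure, `0 < q ≤ ∞`. -/
def qNorm (q : ℝ≥0∞) (s : Set ℝ) (g : ℝ → ℝ≥0∞) : ℝ≥0∞ :=
  eLpNorm g q (volume.restrict s)

/-- `1 / q` as a real number, with `1 / ∞ = 0`. -/
def recip (q : ℝ≥0∞) : ℝ := (q⁻¹).toReal

/-- The weight `t ^ α * b t`, `t > 0`. -/
def weight (α : ℝ) (b : ℝ → ℝ) (t : ℝ) : ℝ≥0∞ := ENNReal.ofReal (t ^ α * b t)

/-- `‖ t^{-1/r} b(t) ‖ u^{α-1/q} a(u) g(u) ‖_{q,(t,∞)} ‖_{r,(0,∞)}`. -/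
def rNorm (α : ℝ) (r : ℝ≥0∞) (b : ℝ → ℝ) (q : ℝ≥0∞) (a : ℝ → ℝ) (g : ℝ → ℝ≥0∞) : ℝ≥0∞ :=
  qNorm r (Ioi 0) fun t =>
    weight (-recip r) b t * qNorm q (Ioi t) fun u => weight (α - recip q) a u * g u

/-- A set of elements of `M` together with an extended-valued size functional, which is the
quasi-norm on that set. -/
structure QSpace (M : Type*) where
  carrier : Set M
  qnorm : M → ℝ≥0∞

namespace QSpace

variable {M : Type*}

/-- The space of all `f` with `N f < ∞`, with quasi-norm `N`. -/
def ofNorm (N : M → ℝ≥0∞) : QSpace M := ⟨{f | N f < ∞}, N⟩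

/-- Continuous embedding `X ⊂ Y`. -/
def Embeds (X Y : QSpace M) : Prop :=
  X.carrier ⊆ Y.carrier ∧ ∃ C : ℝ≥0, ∀ f ∈ X.carrier, Y.qnorm f ≤ C * X.qnorm f

/-- Equality of spaces with equivalence of quasi-norms. -/
def Identical (X Y : QSpace M) : Prop := Embeds X Y ∧ Embeds Y X

variable [Add M]

/-- The sum `A₀ + A₁`. -/
def sum (A₀ A₁ : QSpace M) : Set M :=
  {f | ∃ f₀ ∈ A₀.carrier, ∃ f₁ ∈ A₁.carrier, f = f₀ + f₁}

/-- Peetre's `K`-functional `K(t, f; A₀, A₁)`. -/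
def K (A₀ A₁ : QSpace M) (t : ℝ) (f : M) : ℝ≥0∞ :=
  ⨅ (f₀ ∈ A₀.carrier) (f₁ ∈ A₁.carrier) (_ : f = f₀ + f₁),
    A₀.qnorm f₀ + ENNReal.ofReal t * A₁.qnorm f₁

/-- The `𝓡`-limiting interpolation space of the couple `(A₀, A₁)`. -/
def limitingR (A₀ A₁ : QSpace M) (θ : ℝ) (r : ℝ≥0∞) (b : ℝ → ℝ) (q : ℝ≥0∞) (a : ℝ → ℝ) :
    QSpace M where
  carrier := {f | f ∈ sum A₀ A₁ ∧ rNorm (-θ) r b q a (fun u => K A₀ A₁ u f) < ∞}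
  qnorm f := rNorm (-θ) r b q a (fun u => K A₀ A₁ u f)

end QSpace

variable {Ω : Type*} [MeasurableSpace Ω] {μ : Measure Ω} {𝕜 : Type*} [RCLike 𝕜]

/-- The non-increasing rearrangement `f^*(t) = inf {λ ≥ 0 : μ {|f| > λ} ≤ t}`, `t > 0`. -/
def rearr (f : Ω →ₘ[μ] 𝕜) (t : ℝ) : ℝ≥0∞ :=
  sInf {l : ℝ≥0∞ | μ {x | l < ‖f x‖ₑ} ≤ ENNReal.ofReal t}

/-- The maximal function `f^{**}(t) = (1/t) ∫₀ᵗ f^*(u) du`, `t > 0`. -/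
def maxRearr (f : Ω →ₘ[μ] 𝕜) (t : ℝ) : ℝ≥0∞ :=
  (∫⁻ u in Ioo 0 t, rearr f u) / ENNReal.ofReal t

variable (μ 𝕜)

/-- The Lebesgue space `L_p` as a space of classes of measurable functions. -/
def lebesgue (p : ℝ≥0∞) : QSpace (Ω →ₘ[μ] 𝕜) := .ofNorm fun f => eLpNorm f p μ

/-- The Lorentz–Karamata space `L_{p,q;a}`, defined through `f^*`. -/
def lorentzKaramata (p q : ℝ≥0∞) (a : ℝ → ℝ) : QSpace (Ω →ₘ[μ] 𝕜) :=
  .ofNorm fun f => qNorm q (Ioi 0) fun t => weight (recip p - recip q) a t * rearr f t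

/-- The Lorentz space `L_{p,q}`; in particular `L_{1,∞}`. -/
def lorentz (p q : ℝ≥0∞) : QSpace (Ω →ₘ[μ] 𝕜) := lorentzKaramata μ 𝕜 p q fun _ => 1

/-- The `𝓡` Lorentz–Karamata space `L^𝓡_{p,r,b,q,a}`, defined through `f^*`. -/
def starR (p r : ℝ≥0∞) (b : ℝ → ℝ) (q : ℝ≥0∞) (a : ℝ → ℝ) : QSpace (Ω →ₘ[μ] 𝕜) :=
  .ofNorm fun f => rNorm (recip p) r b q a (rearr f)

/-- The `𝓡` Lorentz–Karamata space `(L)^𝓡_{p,r,b,q,a}`, defined through `f^{**}`. -/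
def maxR (p r : ℝ≥0∞) (b : ℝ → ℝ) (q : ℝ≥0∞) (a : ℝ → ℝ) : QSpace (Ω →ₘ[μ] 𝕜) :=
  .ofNorm fun f => rNorm (recip p) r b q a (maxRearr f)

/-- The grand Lorentz–Karamata space `L^{p),q,r}_b`, defined through `f^*`. -/
def grandStar (p q r : ℝ≥0∞) (b : ℝ → ℝ) : QSpace (Ω →ₘ[μ] 𝕜) :=
  .ofNorm fun f => qNorm r (Ioi 0) fun t => weight (-recip r) b t *
    qNorm q (Ioi t) fun u => ENNReal.ofReal (u ^ (recip p - recip q)) * rearr f u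

/-- The grand Lorentz–Karamata space `(L)^{p),q,r}_b`, defined through `f^{**}`. -/
def grandMax (p q r : ℝ≥0∞) (b : ℝ → ℝ) : QSpace (Ω →ₘ[μ] 𝕜) :=
  .ofNorm fun f => qNorm r (Ioi 0) fun t => weight (-recip r) b t *
    qNorm q (Ioi t) fun u => ENNReal.ofReal (u ^ (recip p - recip q)) * maxRearr f u

end

end LorentzKaramata

namespace LorentzKaramata

/-! The four spaces close up in a cycle of embeddings, each coming from a norm estimate: `(L₁,L_∞)^R
⊂ (L_{1,∞},L_∞)^R ⊂ L^R ⊂ (L)^R ⊂ (L₁,L_∞)^R`. The first is Chebyshev's `t f^*(t) ≤ ‖f‖₁`, the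
second is `t f^*(t) ≤ 2 K(t,f;L_{1,∞},L_∞)`, and the last is `K(t,f;L₁,L_∞) ≤ 2 t f^{**}(t)`,
obtained by cutting `f` at height `f^*(t)`. The factor `t` turns the power `-θ` in the weight into
`1 - θ = 1/p` (`rNorm_mul_id`). The third is Hardy's inequality `exists_rNorm_mean_le`, which needs
`1/p < 1`. The mean of a non-increasing `g` is at most a geometric series of dilates of `g`, and
slow variation makes dilation by `σ` cost at most `C σ^(η-1)` with `η > 0`. The factor `σ` gained
from term to term wins for small `σ`, whatever the quasi-norm constants are, so all `0 < q, r ≤ ∞`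
are treated at once. -/

/-! ### Slowly varying weights and `L_q` norms on half-lines. -/

theorem measurable_weight (α : ℝ) {b : ℝ → ℝ} (hb : IsSlowlyVarying b) :
    AEMeasurable (weight α b) (volume.restrict (Ioi 0)) :=
  ((Measurable.aemeasurable (by fun_prop)).mul hb.measurable).ennreal_ofReal

theorem weight_pos (α : ℝ) {b : ℝ → ℝ} (hb : IsSlowlyVarying b) {t : ℝ} (ht : 0 < t) :
    0 < weight α b t :=
  ENNReal.ofReal_pos.2 (mul_pos (Real.rpow_pos_of_pos ht _) (hb.pos t ht))

theorem isSlowlyVarying_one : IsSlowlyVarying fun _ => 1 where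
  measurable := aemeasurable_const
  pos _ _ := one_pos
  equiv_increasing ε hε := by
    refine ⟨fun t => t ^ ε, fun s hs t _ hst => Real.rpow_le_rpow (le_of_lt hs) hst hε.le, 1,
      one_pos, fun t _ => by simp⟩
  equiv_decreasing ε hε := by
    refine ⟨fun t => t ^ (-ε), fun s hs t _ hst => ?_, 1, one_pos, fun t _ => by simp⟩
    exact Real.rpow_le_rpow_of_nonpos hs hst (by linarith)

/-- A weight at `u` is controlled by the same weight at the smaller point `s * u`. -/
theorem exists_weight_le_dilate {a : ℝ → ℝ} (ha : IsSlowlyVarying a) {ε : ℝ} (hε : 0 < ε) :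
    ∃ C : ℝ, 0 < C ∧ ∀ β s u : ℝ, 0 < s → s ≤ 1 → 0 < u →
      weight β a u ≤ ENNReal.ofReal (C * s ^ (-ε - β)) * weight β a (s * u) := by
  obtain ⟨g, hg, C, hC, h⟩ := ha.equiv_decreasing ε hε
  refine ⟨C * C, by positivity, fun β s u hs hs1 hu => ?_⟩
  have hsu : 0 < s * u := by positivity
  unfold weight
  rw [← ENNReal.ofReal_mul (by positivity)]
  refine ENNReal.ofReal_le_ofReal ?_
  -- One factor `C` to pass to the non-increasing equivalent, one to come back.
  have key : u ^ (-ε) * a u ≤ C * (C * ((s * u) ^ (-ε) * a (s * u))) := by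
    refine (h u hu).1.trans (mul_le_mul_of_nonneg_left ?_ hC.le)
    exact (hg hsu hu (by nlinarith)).trans (h _ hsu).2
  have h1 := mul_le_mul_of_nonneg_left key (Real.rpow_nonneg hu.le (β + ε))
  rw [← mul_assoc, ← Real.rpow_add hu, show β + ε + -ε = β by ring] at h1
  refine h1.trans_eq ?_
  rw [Real.mul_rpow hs.le hu.le, Real.mul_rpow hs.le hu.le, sub_eq_add_neg, Real.rpow_add hs,
    Real.rpow_neg hs.le β, Real.rpow_add hu, Real.rpow_neg hu.le ε]
  have := (Real.rpow_pos_of_pos hu ε).ne'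
  have := (Real.rpow_pos_of_pos hs β).ne'
  field_simp

theorem qNorm_mono {q : ℝ≥0∞} {s : Set ℝ} (hs : MeasurableSet s) {g h : ℝ → ℝ≥0∞}
    (H : ∀ u ∈ s, g u ≤ h u) : qNorm q s g ≤ qNorm q s h :=
  eLpNorm_mono_enorm_ae ((ae_restrict_iff' hs).2 (.of_forall fun u hu => by simpa using H u hu))

theorem qNorm_le_mul {q : ℝ≥0∞} {s : Set ℝ} (hs : MeasurableSet s) {g h : ℝ → ℝ≥0∞} {c : ℝ≥0∞}
    (hc : c ≠ ∞) (H : ∀ u ∈ s, g u ≤ c * h u) : qNorm q s g ≤ c * qNorm q s h := by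
  lift c to ℝ≥0 using hc
  exact eLpNorm_le_mul_eLpNorm_of_ae_le_mul'
    ((ae_restrict_iff' hs).2 (.of_forall fun u hu => by simpa using H u hu)) q

theorem qNorm_anti_left (q : ℝ≥0∞) (h : ℝ → ℝ≥0∞) : Antitone fun t => qNorm q (Ioi t) h :=
  fun _ _ hst => eLpNorm_mono_measure h (Measure.restrict_mono (Ioi_subset_Ioi hst) le_rfl)

theorem qNorm_add_le {q : ℝ≥0∞} {s : Set ℝ} {g h : ℝ → ℝ≥0∞}
    (hg : AEMeasurable g (volume.restrict s)) (hh : AEMeasurable h (volume.restrict s)) :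
    qNorm q s (fun u => g u + h u) ≤ ENNReal.LpAddConst q * (qNorm q s g + qNorm q s h) :=
  eLpNorm_add_le' hg.aestronglyMeasurable hh.aestronglyMeasurable q

theorem qNorm_dilate (q : ℝ≥0∞) {s : ℝ} (hs : 0 < s) (t : ℝ) (h : ℝ → ℝ≥0∞) :
    qNorm q (Ioi t) (fun u => h (s * u)) =
      ENNReal.ofReal (s ^ (-recip q)) * qNorm q (Ioi (s * t)) h := by
  have he : MeasurableEmbedding (s * · : ℝ → ℝ) := measurableEmbedding_mulLeft₀ hs.ne'
  have h1 : (volume.restrict (Ioi t)).map (s * ·) =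
      ENNReal.ofReal s⁻¹ • (volume.restrict (Ioi (s * t)) : Measure ℝ) := by
    have := he.restrict_map volume (Ioi (s * t))
    rw [Real.map_volume_mul_left hs.ne', abs_of_pos (inv_pos.2 hs), Measure.restrict_smul] at this
    rw [this]
    congr 2
    ext u
    rw [mem_preimage, mem_Ioi, mem_Ioi, mul_lt_mul_iff_right₀ hs]
  have h2 := he.eLpNorm_map_measure (g := h) (p := q) (μ := volume.restrict (Ioi t))
  unfold qNorm
  change eLpNorm (h ∘ (s * ·)) q _ = _
  rw [← h2, h1, eLpNorm_smul_measure_of_ne_zero (by simpa using hs), smul_eq_mul, one_div, recip,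
    ENNReal.ofReal_rpow_of_pos (inv_pos.2 hs), Real.inv_rpow hs.le, Real.rpow_neg hs.le]

/-- Monotone convergence for finite `q`, since powers commute with suprema; for `q = ∞`, countably
many null sets are discarded. -/
theorem qNorm_iSup_le {q : ℝ≥0∞} {s : Set ℝ} {h : ℕ → ℝ → ℝ≥0∞} (hm : Monotone h)
    (hh : ∀ n, AEMeasurable (h n) (volume.restrict s)) :
    qNorm q s (fun u => ⨆ n, h n u) ≤ ⨆ n, qNorm q s (h n) := by
  unfold qNorm
  by_cases hq0 : q = 0
  · simp [hq0]
  by_cases hq : q = ∞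
  · subst hq
    simp only [eLpNorm_exponent_top, eLpNormEssSup, enorm_eq_self]
    refine essSup_le_of_ae_le _ ?_
    have : ∀ᵐ u ∂volume.restrict s, ∀ n, h n u ≤ essSup (h n) (volume.restrict s) :=
      ae_all_iff.2 fun n => ENNReal.ae_le_essSup _
    filter_upwards [this] with u hu
    exact iSup_mono hu
  · have hq' : 0 < q.toReal := ENNReal.toReal_pos hq0 hq
    have e1 : ∀ u, (⨆ n, h n u) ^ q.toReal = ⨆ n, h n u ^ q.toReal := fun u =>
      (ENNReal.orderIsoRpow _ hq').map_iSup _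
    simp only [eLpNorm_eq_lintegral_rpow_enorm_toReal hq0 hq, enorm_eq_self, e1]
    rw [lintegral_iSup' (fun n => (hh n).pow_const _)
      (.of_forall fun u i j hij => ENNReal.rpow_le_rpow (hm hij u) hq'.le)]
    exact ((ENNReal.orderIsoRpow _ (one_div_pos.2 hq')).map_iSup _).le

/-! ### The iterated `𝓡`-norm: quasi-triangle inequality, monotone convergence, dilations. -/

section rNorm

variable {α : ℝ} {r q : ℝ≥0∞} {a b : ℝ → ℝ}

theorem rNorm_le_mul {g h : ℝ → ℝ≥0∞} {c : ℝ≥0∞} (hc : c ≠ ∞)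
    (H : ∀ u, 0 < u → g u ≤ c * h u) : rNorm α r b q a g ≤ c * rNorm α r b q a h := by
  refine qNorm_le_mul measurableSet_Ioi hc fun t ht => ?_
  rw [mul_left_comm]
  refine mul_le_mul_right (qNorm_le_mul measurableSet_Ioi hc fun u hu => ?_) _
  rw [mul_left_comm]
  exact mul_le_mul_right (H u (lt_trans ht hu)) _

theorem rNorm_mono {g h : ℝ → ℝ≥0∞} (H : ∀ u, 0 < u → g u ≤ h u) :
    rNorm α r b q a g ≤ rNorm α r b q a h := by
  simpa using rNorm_le_mul (c := 1) (h := h) (by simp) (by simpa using H)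

/-- A change of the power in the weight is absorbed by the argument. -/
theorem rNorm_mul_id (g : ℝ → ℝ≥0∞) :
    rNorm α r b q a (fun u => ENNReal.ofReal u * g u) = rNorm (α + 1) r b q a g := by
  have key : ∀ u, 0 < u → weight (α - recip q) a u * (ENNReal.ofReal u * g u) =
      weight (α + 1 - recip q) a u * g u := fun u hu => by
    rw [← mul_assoc, weight, weight, ← ENNReal.ofReal_mul' hu.le,
      show α + 1 - recip q = α - recip q + 1 by ring, Real.rpow_add hu, Real.rpow_one]
    ring_nf
  unfold rNorm
  refine le_antisymm ?_ ?_ <;>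
  · refine qNorm_mono measurableSet_Ioi fun t ht => mul_le_mul_right ?_ _
    refine qNorm_mono measurableSet_Ioi fun u hu => ?_
    rw [key u (lt_trans ht hu)]

/-- The inner norm is monotone in `t`, hence measurable for arbitrary `h`. -/
theorem measurable_weight_mul_qNorm (hb : IsSlowlyVarying b) (h : ℝ → ℝ≥0∞) :
    AEMeasurable (fun t => weight (-recip r) b t * qNorm q (Ioi t) h)
      (volume.restrict (Ioi 0)) :=
  (measurable_weight _ hb).mul (qNorm_anti_left q h).measurable.aemeasurable

theorem measurable_weight_mul (ha : IsSlowlyVarying a) {g : ℝ → ℝ≥0∞} (hg : Measurable g)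
    {t : ℝ} (ht : 0 ≤ t) :
    AEMeasurable (fun u => weight (α - recip q) a u * g u) (volume.restrict (Ioi t)) :=
  ((measurable_weight _ ha).mul hg.aemeasurable).mono_measure
    (Measure.restrict_mono (Ioi_subset_Ioi ht) le_rfl)

theorem rNorm_add_le (ha : IsSlowlyVarying a) (hb : IsSlowlyVarying b) {g h : ℝ → ℝ≥0∞}
    (hg : Measurable g) (hh : Measurable h) :
    rNorm α r b q a (fun u => g u + h u) ≤
      ENNReal.LpAddConst q * ENNReal.LpAddConst r * (rNorm α r b q a g + rNorm α r b q a h) := by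
  rw [mul_assoc]
  refine le_trans ?_ (mul_le_mul_right (qNorm_add_le (measurable_weight_mul_qNorm hb _)
    (measurable_weight_mul_qNorm hb _)) _)
  refine qNorm_le_mul measurableSet_Ioi (ENNReal.LpAddConst_lt_top q).ne fun t ht => ?_
  rw [← mul_add, mul_left_comm]
  refine mul_le_mul_right ?_ _
  refine le_of_eq_of_le ?_ (qNorm_add_le (measurable_weight_mul ha hg (le_of_lt ht))
    (measurable_weight_mul ha hh (le_of_lt ht)))
  simp only [mul_add]

theorem rNorm_iSup_le (ha : IsSlowlyVarying a) (hb : IsSlowlyVarying b) {h : ℕ → ℝ → ℝ≥0∞}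
    (hm : Monotone h) (hh : ∀ n, Measurable (h n)) :
    rNorm α r b q a (fun u => ⨆ n, h n u) ≤ ⨆ n, rNorm α r b q a (h n) := by
  refine le_trans ?_ (qNorm_iSup_le (fun i j hij t => ?_) fun n =>
    measurable_weight_mul_qNorm hb _)
  · refine qNorm_mono measurableSet_Ioi fun t ht => ?_
    rw [← ENNReal.mul_iSup]
    refine mul_le_mul_right ?_ _
    simp only [ENNReal.mul_iSup]
    exact qNorm_iSup_le (fun i j hij u => mul_le_mul_right (hm hij u) _)
      fun n => measurable_weight_mul ha (hh n) (le_of_lt ht)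
  · exact mul_le_mul_right (qNorm_mono measurableSet_Ioi
      fun u _ => mul_le_mul_right (hm hij u) _) _

/-- Each slowly varying weight loses `s^(-ε)`. The powers `1/q` and `1/r` in the weights cancel
against the Jacobians of the two changes of variable. -/
theorem exists_rNorm_dilate_le (α : ℝ) (r q : ℝ≥0∞) (ha : IsSlowlyVarying a)
    (hb : IsSlowlyVarying b) {ε : ℝ} (hε : 0 < ε) :
    ∃ C : ℝ, 0 < C ∧ ∀ s : ℝ, 0 < s → s ≤ 1 → ∀ g : ℝ → ℝ≥0∞,
      rNorm α r b q a (fun u => g (s * u)) ≤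
        ENNReal.ofReal (C * s ^ (-α - 2 * ε)) * rNorm α r b q a g := by
  obtain ⟨A, hA, hA'⟩ := exists_weight_le_dilate ha hε
  obtain ⟨B, hB, hB'⟩ := exists_weight_le_dilate hb hε
  refine ⟨A * B, by positivity, fun s hs hs1 g => ?_⟩
  set I : ℝ → ℝ≥0∞ := fun t => qNorm q (Ioi t) fun u => weight (α - recip q) a u * g u with hI
  have inner : ∀ t, 0 < t → (qNorm q (Ioi t) fun u => weight (α - recip q) a u * g (s * u)) ≤
      ENNReal.ofReal (A * s ^ (-ε - α)) * I (s * t) := fun t ht => by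
    have h1 := qNorm_le_mul (q := q) (s := Ioi t) measurableSet_Ioi
      (g := fun u => weight (α - recip q) a u * g (s * u))
      (h := fun u => weight (α - recip q) a (s * u) * g (s * u))
      (c := ENNReal.ofReal (A * s ^ (-ε - (α - recip q)))) ENNReal.ofReal_ne_top
      fun u hu => by
        rw [← mul_assoc]
        exact mul_le_mul_left (hA' _ s u hs hs1 (lt_trans ht hu)) _
    refine h1.trans_eq ?_
    rw [qNorm_dilate q hs t fun u => weight (α - recip q) a u * g u, ← mul_assoc,
      ← ENNReal.ofReal_mul (by positivity), mul_assoc, ← Real.rpow_add hs]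
    ring_nf
    simp only [hI, mul_comm]
  have outer := qNorm_le_mul (q := r) (s := Ioi 0) measurableSet_Ioi
      (g := fun t => weight (-recip r) b t *
        qNorm q (Ioi t) fun u => weight (α - recip q) a u * g (s * u))
      (h := fun t => weight (-recip r) b (s * t) * I (s * t))
      (c := ENNReal.ofReal (B * s ^ (-ε - -recip r)) * ENNReal.ofReal (A * s ^ (-ε - α)))
      (by finiteness) fun t ht => by
        rw [mul_mul_mul_comm]
        exact mul_le_mul' (hB' _ s t hs hs1 ht) (inner t ht)
  refine outer.trans_eq ?_
  rw [qNorm_dilate r hs 0 fun t => weight (-recip r) b t * I t, mul_zero, ← mul_assoc,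
    ← ENNReal.ofReal_mul (by positivity), ← ENNReal.ofReal_mul (by positivity)]
  congr 2
  rw [show -α - 2 * ε = (-ε - -recip r) + (-ε - α) + -recip r by ring, Real.rpow_add hs,
    Real.rpow_add hs]
  ring

/-- Applied to `f^{**}`, one finite value is enough to put `f` in `L₁ + L_∞`. -/
theorem exists_lt_top_of_rNorm_lt_top (hq : 0 < q) (hr : 0 < r) (ha : IsSlowlyVarying a)
    (hb : IsSlowlyVarying b) {g : ℝ → ℝ≥0∞} (hg : rNorm α r b q a g < ∞) :
    ∃ u, 0 < u ∧ g u < ∞ := by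
  by_contra! H
  have top : ∀ (q : ℝ≥0∞), 0 < q → ∀ t : ℝ, qNorm q (Ioi t) (fun _ => ∞) = ∞ := fun q hq t => by
    unfold qNorm
    rw [eLpNorm_const _ hq.ne' (by simp)]
    refine ENNReal.top_mul ?_
    simp
  refine hg.ne (top_le_iff.1 ?_)
  rw [← top r hr 0]
  refine qNorm_mono measurableSet_Ioi fun t ht => ?_
  have : (qNorm q (Ioi t) fun u => weight (α - recip q) a u * g u) = ∞ := by
    rw [← top_le_iff, ← top q hq t]
    refine qNorm_mono measurableSet_Ioi fun u hu => ?_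
    have hu0 : 0 < u := lt_trans ht hu
    rw [top_le_iff.1 (H u hu0), ENNReal.mul_top (weight_pos _ ha hu0).ne']
  rw [this, ENNReal.mul_top (weight_pos _ hb ht).ne']

end rNorm

/-! ### Hardy's inequality. -/

/-- The mean of a non-increasing function is dominated by a geometric series of its dilates. -/
theorem lintegral_div_le_tsum {g : ℝ → ℝ≥0∞} (hg : Antitone g) {σ : ℝ} (h0 : 0 < σ)
    (h1 : σ < 1) {u : ℝ} (hu : 0 < u) :
    (∫⁻ v in Ioo 0 u, g v) / ENNReal.ofReal u ≤
      ∑' k : ℕ, ENNReal.ofReal (σ ^ k) * g (σ ^ (k + 1) * u) := by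
  have hsub : Ioo 0 u ⊆ ⋃ k : ℕ, Ioc (σ ^ (k + 1) * u) (σ ^ k * u) := fun v hv => by
    obtain ⟨k, hk, hk'⟩ := exists_nat_pow_near_of_lt_one (x := v / u) (div_pos hv.1 hu)
      ((div_le_one hu).2 hv.2.le) h0 h1
    exact mem_iUnion.2 ⟨k, (lt_div_iff₀ hu).1 hk, (div_le_iff₀ hu).1 hk'⟩
  refine ENNReal.div_le_of_le_mul ?_
  calc ∫⁻ v in Ioo 0 u, g v
      ≤ ∫⁻ v in ⋃ k : ℕ, Ioc (σ ^ (k + 1) * u) (σ ^ k * u), g v := lintegral_mono_set hsub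
    _ ≤ ∑' k : ℕ, ∫⁻ v in Ioc (σ ^ (k + 1) * u) (σ ^ k * u), g v := lintegral_iUnion_le _ _
    _ ≤ ∑' k : ℕ, ENNReal.ofReal (σ ^ k) * g (σ ^ (k + 1) * u) * ENNReal.ofReal u := by
      -- On each piece `g` is at most its value at the left endpoint, and the length is at most `σ^k
      -- u`.
      refine ENNReal.tsum_le_tsum fun k => ?_
      refine (setLIntegral_mono' measurableSet_Ioc fun v hv => hg hv.1.le).trans ?_
      rw [setLIntegral_const, Real.volume_Ioc, mul_right_comm,
        ← ENNReal.ofReal_mul (by positivity), mul_comm]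
      refine mul_le_mul_left (ENNReal.ofReal_le_ofReal ?_) _
      have : 0 < σ ^ (k + 1) * u := by positivity
      linarith
    _ = _ := ENNReal.tsum_mul_right

/-- Hardy's inequality for non-increasing functions in the `𝓡`-norm. -/
theorem exists_rNorm_mean_le {α : ℝ} (hα : α < 1) (r q : ℝ≥0∞) {a b : ℝ → ℝ}
    (ha : IsSlowlyVarying a) (hb : IsSlowlyVarying b) :
    ∃ C : ℝ≥0, ∀ g : ℝ → ℝ≥0∞, Antitone g →
      rNorm α r b q a (fun u => (∫⁻ v in Ioo 0 u, g v) / ENNReal.ofReal u) ≤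
        C * rNorm α r b q a g := by
  -- With this `ε` the two losses use up half of the gap `1 - α`; the other half is `η`.
  obtain ⟨C, hC, hdil⟩ := exists_rNorm_dilate_le α r q ha hb (ε := (1 - α) / 4) (by linarith)
  set η : ℝ := (1 - α) / 2 with hη
  have hη0 : 0 < η := by linarith
  have hexp : -α - 2 * ((1 - α) / 4) = η - 1 := by rw [hη]; ring
  rw [hexp] at hdil
  have hDtop : ENNReal.LpAddConst q * ENNReal.LpAddConst r ≠ ∞ :=
    ENNReal.mul_ne_top (ENNReal.LpAddConst_lt_top q).ne (ENNReal.LpAddConst_lt_top r).ne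
  set D : ℝ := (ENNReal.LpAddConst q * ENNReal.LpAddConst r).toReal with hD
  have hDe : ENNReal.LpAddConst q * ENNReal.LpAddConst r = ENNReal.ofReal D :=
    (ENNReal.ofReal_toReal hDtop).symm
  have hD0 : 0 ≤ D := ENNReal.toReal_nonneg
  have hDC : 0 ≤ D * C := by positivity
  -- Chosen so that `σ^η = x` satisfies `D C σ^η ≤ 1/2`; the `+ 2` keeps `x < 1` for every `D C ≥
  -- 0`.
  set x : ℝ := 1 / (2 * (D * C) + 2) with hx
  have hx0 : 0 < x := by positivity
  have hx1 : x < 1 := by rw [hx, div_lt_one (by positivity)]; linarith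
  set σ : ℝ := x ^ (1 / η) with hσ
  have h0 : 0 < σ := Real.rpow_pos_of_pos hx0 _
  have h1 : σ < 1 := Real.rpow_lt_one hx0.le hx1 (by positivity)
  have hση : σ ^ η = x := by rw [hσ, ← Real.rpow_mul hx0.le, one_div_mul_cancel hη0.ne',
    Real.rpow_one]
  have hsmall : D * (C * σ ^ (η - 1) * σ) ≤ 1 / 2 := by
    rw [mul_assoc C, ← Real.rpow_add_one h0.ne', sub_add_cancel, hση, hx, ← mul_assoc,
      mul_one_div, div_le_div_iff₀ (by positivity) (by positivity)]
    linarith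
  set B : ℝ := D * (C * σ ^ (η - 1)) with hB
  have hB0 : 0 ≤ B := by positivity
  refine ⟨(2 * B).toNNReal, fun g hg => ?_⟩
  change _ ≤ ENNReal.ofReal (2 * B) * _
  set G : ℕ → ℝ → ℝ≥0∞ := fun n u =>
    ∑ k ∈ Finset.range n, ENNReal.ofReal (σ ^ k) * g (σ ^ (k + 1) * u) with hG
  have hGm : ∀ n, Measurable (G n) := fun n =>
    Finset.measurable_fun_sum _ fun k _ =>
      (hg.measurable.comp (measurable_const_mul _)).const_mul _
  have hGmono : Monotone G := fun m n hmn u =>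
    Finset.sum_le_sum_of_subset (Finset.range_subset_range.2 hmn)
  -- Self-similarity of the partial sums: peeling off the first term calls for the quasi-triangle
  -- inequality only once per step, and the contraction `1/2` absorbs its constant. The bound `2B`
  -- is the fixed point of `y ↦ B + y/2`.
  have hGsucc : ∀ n, G (n + 1) = fun u => g (σ * u) + ENNReal.ofReal σ * G n (σ * u) := fun n => by
    funext u
    simp only [hG, Finset.sum_range_succ', Finset.mul_sum]
    rw [add_comm]
    congr 1
    · simp
    · refine Finset.sum_congr rfl fun k _ => ?_
      rw [← mul_assoc, ← ENNReal.ofReal_mul h0.le]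
      ring_nf
  have hGle : ∀ n, rNorm α r b q a (G n) ≤ ENNReal.ofReal (2 * B) * rNorm α r b q a g := by
    intro n
    induction n with
    | zero =>
      have := rNorm_le_mul (α := α) (r := r) (q := q) (a := a) (b := b) (g := G 0) (h := g)
        (c := 0) (by simp) (by simp [hG])
      rw [zero_mul] at this
      exact this.trans zero_le
    | succ n ih =>
      have e1 := hdil σ h0 h1.le g
      have e2 : rNorm α r b q a (fun u => ENNReal.ofReal σ * G n (σ * u)) ≤
          ENNReal.ofReal σ * (ENNReal.ofReal (C * σ ^ (η - 1)) *
            (ENNReal.ofReal (2 * B) * rNorm α r b q a g)) :=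
        (rNorm_le_mul ENNReal.ofReal_ne_top fun u _ => le_rfl).trans
          (mul_le_mul_right ((hdil σ h0 h1.le (G n)).trans (mul_le_mul_right ih _)) _)
      rw [hGsucc]
      refine (rNorm_add_le ha hb (hg.measurable.comp (measurable_const_mul _))
        (((hGm n).comp (measurable_const_mul _)).const_mul _)).trans ?_
      refine (mul_le_mul_right (add_le_add e1 e2) _).trans ?_
      rw [hDe, ← mul_assoc (ENNReal.ofReal (C * _)), ← mul_assoc (ENNReal.ofReal σ), ← add_mul,
        ← mul_assoc, ← ENNReal.ofReal_mul (by positivity), ← ENNReal.ofReal_mul (by positivity),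
        ← ENNReal.ofReal_add (by positivity) (by positivity), ← ENNReal.ofReal_mul hD0]
      refine mul_le_mul_left (ENNReal.ofReal_le_ofReal ?_) _
      calc D * (C * σ ^ (η - 1) + σ * (C * σ ^ (η - 1) * (2 * B)))
          = B + D * (C * σ ^ (η - 1) * σ) * (2 * B) := by rw [hB]; ring
        _ ≤ B + 1 / 2 * (2 * B) := by gcongr
        _ = 2 * B := by ring
  refine (rNorm_mono fun u hu => ?_).trans ((rNorm_iSup_le ha hb hGmono hGm).trans (iSup_le hGle))
  exact (lintegral_div_le_tsum hg h0 h1 hu).trans_eq ENNReal.tsum_eq_iSup_nat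


/-! ### Rearrangements and the splitting of `f` at a height. -/

section rearr

variable {Ω : Type*} [MeasurableSpace Ω] {μ : Measure Ω} {𝕜 : Type*} [RCLike 𝕜]

/-- Monotone on all of `ℝ`, because `ENNReal.ofReal` sends negative `t` to `0`. -/
theorem rearr_antitone (f : Ω →ₘ[μ] 𝕜) : Antitone (rearr f) := fun _ _ hst =>
  sInf_le_sInf fun _ hl => le_trans hl (ENNReal.ofReal_le_ofReal hst)

/-- The infimum defining the rearrangement is attained. -/
theorem measure_rearr_lt_le (f : Ω →ₘ[μ] 𝕜) (t : ℝ) :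
    μ {x | rearr f t < ‖f x‖ₑ} ≤ ENNReal.ofReal t := by
  set S : Set ℝ≥0∞ := {l | μ {x | l < ‖f x‖ₑ} ≤ ENNReal.ofReal t} with hS
  obtain ⟨l, hl, hlim, hmem⟩ := exists_seq_tendsto_sInf (S := S) ⟨∞, by simp [hS]⟩
    (OrderBot.bddBelow S)
  have hU : {x | rearr f t < ‖f x‖ₑ} ⊆ ⋃ n, {x | l n < ‖f x‖ₑ} := fun x hx =>
    mem_iUnion.2 (hlim.eventually_lt_const hx).exists
  have hmono : Monotone fun n => {x | l n < ‖f x‖ₑ} := fun m n hmn x hx =>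
    lt_of_le_of_lt (hl hmn) hx
  refine (measure_mono hU).trans ?_
  rw [hmono.measure_iUnion]
  exact iSup_le hmem

theorem rearr_le_iff (f : Ω →ₘ[μ] 𝕜) (t : ℝ) (l : ℝ≥0∞) :
    rearr f t ≤ l ↔ μ {x | l < ‖f x‖ₑ} ≤ ENNReal.ofReal t :=
  ⟨fun h => (measure_mono fun _ hx => lt_of_le_of_lt h hx).trans (measure_rearr_lt_le f t),
    fun h => sInf_le h⟩

theorem rearr_add_le (f g : Ω →ₘ[μ] 𝕜) (t : ℝ) :
    rearr (f + g) t ≤ rearr f t + eLpNorm g ∞ μ := by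
  rw [rearr_le_iff]
  refine le_trans (measure_mono_ae ?_) (measure_rearr_lt_le f t)
  have hg : ∀ᵐ x ∂μ, ‖g x‖ₑ ≤ eLpNorm g ∞ μ := by
    rw [eLpNorm_exponent_top]
    exact ae_le_eLpNormEssSup
  filter_upwards [AEEqFun.coeFn_add f g, hg] with x hx hgx hlt
  by_contra hle
  refine absurd (show rearr f t + eLpNorm g ∞ μ < ‖(f + g) x‖ₑ from hlt) (not_lt.2 ?_)
  rw [hx]
  exact (enorm_add_le _ _).trans (add_le_add (not_lt.1 hle) hgx)

theorem ofReal_mul_rearr_le_eLpNorm_one (f : Ω →ₘ[μ] 𝕜) {t : ℝ} (ht : 0 < t) :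
    ENNReal.ofReal t * rearr f t ≤ eLpNorm f 1 μ := by
  have ht' : ENNReal.ofReal t ≠ 0 := by simpa using ht
  rw [eLpNorm_one_eq_lintegral_enorm, mul_comm, ← ENNReal.le_div_iff_mul_le (.inl ht')
    (.inl ENNReal.ofReal_ne_top), rearr_le_iff]
  set N := ∫⁻ x, ‖f x‖ₑ ∂μ with hN
  have hm : AEMeasurable (fun x => ‖f x‖ₑ) μ := f.stronglyMeasurable.enorm.aemeasurable
  -- The extreme values of `N` are set apart because `N / (N / t) = t` fails for them.
  rcases eq_or_ne N 0 with h0 | h0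
  · have h1 : (fun x => ‖f x‖ₑ) =ᵐ[μ] 0 := (lintegral_eq_zero_iff' hm).1 h0
    have : μ {x | N / ENNReal.ofReal t < ‖f x‖ₑ} = 0 := by
      refine measure_mono_null (fun x hx => ?_) h1
      exact (lt_of_le_of_lt zero_le hx).ne'
    rw [this]
    exact zero_le
  rcases eq_or_ne N ∞ with h1 | h1
  · simp [h1, ENNReal.top_div_of_ne_top]
  have hl0 : N / ENNReal.ofReal t ≠ 0 := ENNReal.div_ne_zero.2 ⟨h0, ENNReal.ofReal_ne_top⟩
  have hlt : N / ENNReal.ofReal t ≠ ∞ := ENNReal.div_ne_top h1 ht'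
  calc μ {x | N / ENNReal.ofReal t < ‖f x‖ₑ}
      ≤ μ {x | N / ENNReal.ofReal t ≤ ‖f x‖ₑ} := measure_mono fun x hx => by
        exact le_of_lt (show N / ENNReal.ofReal t < ‖f x‖ₑ from hx)
    _ ≤ N / (N / ENNReal.ofReal t) := meas_ge_le_lintegral_div hm hl0 hlt
    _ = ENNReal.ofReal t := ENNReal.div_div_cancel h0 h1

/-- The part of `f` above the level `f^*(t)` has its integral controlled by `∫₀ᵗ f^*`. -/
theorem setLIntegral_rearr_lt_le (f : Ω →ₘ[μ] 𝕜) (t : ℝ) :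
    ∫⁻ x in {x | rearr f t < ‖f x‖ₑ}, ‖f x‖ₑ ∂μ ≤ ∫⁻ u in Ioo 0 t, rearr f u := by
  by_cases hfin : ∫⁻ u in Ioo 0 t, rearr f u = ∞
  · simp [hfin]
  set E := {x | rearr f t < ‖f x‖ₑ} with hE
  have hEm : MeasurableSet E := measurableSet_lt measurable_const f.stronglyMeasurable.enorm
  have hae : ∀ᵐ u ∂volume.restrict (Ioo 0 t), rearr f u < ∞ :=
    ae_lt_top (rearr_antitone f).measurable hfin
  -- Layer cake on both sides reduces the claim to a comparison of distribution functions at each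
  -- level `s`.
  have hL : ∫⁻ x in E, ‖f x‖ₑ ∂μ = ∫⁻ s in Ioi 0, μ.restrict E {x | s < ‖f x‖} := by
    simp only [← ofReal_norm]
    exact lintegral_eq_lintegral_meas_lt _ (.of_forall fun x => norm_nonneg _)
      f.stronglyMeasurable.norm.measurable.aemeasurable
  have hR : ∫⁻ u in Ioo 0 t, rearr f u =
      ∫⁻ s in Ioi 0, volume.restrict (Ioo 0 t) {u | s < (rearr f u).toReal} := by
    rw [← lintegral_eq_lintegral_meas_lt _ (.of_forall fun x => ENNReal.toReal_nonneg)
      (rearr_antitone f).measurable.ennreal_toReal.aemeasurable]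
    refine lintegral_congr_ae ?_
    filter_upwards [hae] with u hu
    rw [ENNReal.ofReal_toReal hu.ne]
  rw [hL, hR]
  refine setLIntegral_mono' measurableSet_Ioi fun s hs => ?_
  set l : ℝ≥0∞ := max (ENNReal.ofReal s) (rearr f t) with hl
  have hset : μ.restrict E {x | s < ‖f x‖} = μ {x | l < ‖f x‖ₑ} := by
    rw [Measure.restrict_apply' hEm]
    congr 1
    ext x
    simp only [hE, hl, mem_inter_iff, mem_ofPred_eq, max_lt_iff, ← ofReal_norm]
    rw [ENNReal.ofReal_lt_ofReal_iff_of_nonneg (le_of_lt hs)]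
  rw [hset]
  set m := μ {x | l < ‖f x‖ₑ} with hm
  have hmt : m ≤ ENNReal.ofReal t := (rearr_le_iff f t l).1 (le_max_right _ _)
  have hmtop : m ≠ ∞ := ne_top_of_le_ne_top ENNReal.ofReal_ne_top hmt
  calc m = volume (Ioo 0 m.toReal) := by rw [Real.volume_Ioo, sub_zero, ENNReal.ofReal_toReal hmtop]
    _ = volume.restrict (Ioo 0 t) (Ioo 0 m.toReal) := by
      rw [Measure.restrict_apply measurableSet_Ioo, inter_eq_left.2]
      rcases le_or_gt t 0 with ht | ht
      · have : m = 0 := by simpa [ENNReal.ofReal_of_nonpos ht] using hmt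
        simp [this]
      · exact Ioo_subset_Ioo_right (ENNReal.toReal_le_of_le_ofReal ht.le hmt)
    -- If `u < m = μ {|f| > l}`, then `f^*(u) > l ≥ s` by `rearr_le_iff`.
    _ ≤ volume.restrict (Ioo 0 t) {u | s < (rearr f u).toReal} := by
      refine measure_mono_ae ?_
      filter_upwards [hae] with u hu hum
      have hum' : u ∈ Ioo 0 m.toReal := hum
      have h1 : ENNReal.ofReal u < m := (ENNReal.ofReal_lt_iff_lt_toReal hum'.1.le hmtop).2 hum'.2
      have h2 : l < rearr f u := not_le.1 fun h => not_le.2 h1 ((rearr_le_iff f u l).1 h)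
      exact (ENNReal.ofReal_lt_iff_lt_toReal (le_of_lt hs) hu.ne).1
        (lt_of_le_of_lt (le_max_left _ _) h2)

theorem ofReal_mul_rearr_le_lintegral (f : Ω →ₘ[μ] 𝕜) (t : ℝ) :
    ENNReal.ofReal t * rearr f t ≤ ∫⁻ u in Ioo 0 t, rearr f u := by
  have := setLIntegral_mono' (μ := volume) (s := Ioo 0 t) measurableSet_Ioo
    (f := fun _ => rearr f t) fun u hu => rearr_antitone f hu.2.le
  rwa [setLIntegral_const, Real.volume_Ioo, sub_zero, mul_comm] at this

/-- Splitting `f` at the height `f^*(t)`. -/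
theorem exists_decomposition (f : Ω →ₘ[μ] 𝕜) (t : ℝ) :
    ∃ f₀ f₁ : Ω →ₘ[μ] 𝕜, f = f₀ + f₁ ∧ eLpNorm f₀ 1 μ ≤ ∫⁻ u in Ioo 0 t, rearr f u ∧
      eLpNorm f₁ ∞ μ ≤ rearr f t := by
  set E := {x | rearr f t < ‖f x‖ₑ} with hE
  have hEm : MeasurableSet E := measurableSet_lt measurable_const f.stronglyMeasurable.enorm
  have h0 : AEStronglyMeasurable (E.indicator f) μ :=
    (f.stronglyMeasurable.indicator hEm).aestronglyMeasurable
  have h1 : AEStronglyMeasurable (Eᶜ.indicator f) μ :=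
    (f.stronglyMeasurable.indicator hEm.compl).aestronglyMeasurable
  refine ⟨AEEqFun.mk _ h0, AEEqFun.mk _ h1, ?_, ?_, ?_⟩
  · refine AEEqFun.ext ?_
    filter_upwards [AEEqFun.coeFn_add (AEEqFun.mk _ h0) (AEEqFun.mk _ h1), AEEqFun.coeFn_mk _ h0,
      AEEqFun.coeFn_mk _ h1] with x hx hx0 hx1
    rw [hx, Pi.add_apply, hx0, hx1]
    exact (congrFun (indicator_self_add_compl E f) x).symm
  · rw [eLpNorm_congr_ae (AEEqFun.coeFn_mk _ h0), eLpNorm_indicator_eq_eLpNorm_restrict hEm,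
      eLpNorm_one_eq_lintegral_enorm]
    exact setLIntegral_rearr_lt_le f t
  · rw [eLpNorm_congr_ae (AEEqFun.coeFn_mk _ h1), eLpNorm_exponent_top]
    refine essSup_le_of_ae_le _ (.of_forall fun x => ?_)
    by_cases hx : x ∈ E
    · simp [hx]
    · simpa [hx] using not_lt.1 hx

/-! ### Bounds for the `K`-functionals of the two couples. -/

theorem lorentz_one_top_qnorm (f : Ω →ₘ[μ] 𝕜) :
    (lorentz μ 𝕜 1 ∞).qnorm f = qNorm ∞ (Ioi 0) fun t => ENNReal.ofReal t * rearr f t := by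
  simp [lorentz, lorentzKaramata, QSpace.ofNorm, recip, weight]

theorem lorentz_one_top_qnorm_le (f : Ω →ₘ[μ] 𝕜) :
    (lorentz μ 𝕜 1 ∞).qnorm f ≤ (lebesgue μ 𝕜 1).qnorm f := by
  rw [lorentz_one_top_qnorm, qNorm, eLpNorm_exponent_top]
  refine essSup_le_of_ae_le _ ((ae_restrict_iff' measurableSet_Ioi).2 (.of_forall fun t ht => ?_))
  exact ofReal_mul_rearr_le_eLpNorm_one f ht

/-- The norm is an essential supremum, so the bound is taken at some good `s` in `(t/2, t)` and
carried to `t` by monotonicity of `f^*`; this costs the factor `2`. -/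
theorem ofReal_mul_rearr_le_lorentz (f : Ω →ₘ[μ] 𝕜) {t : ℝ} (ht : 0 < t) :
    ENNReal.ofReal t * rearr f t ≤ 2 * (lorentz μ 𝕜 1 ∞).qnorm f := by
  rw [lorentz_one_top_qnorm, qNorm, eLpNorm_exponent_top]
  set N := eLpNormEssSup (fun t => ENNReal.ofReal t * rearr f t) (volume.restrict (Ioi 0)) with hN
  have h1 : ∀ᵐ s ∂volume.restrict (Ioi (0 : ℝ)), ENNReal.ofReal s * rearr f s ≤ N :=
    ae_le_eLpNormEssSup
  have h2 : ∀ᵐ s ∂volume.restrict (Ioo (t / 2) t), ENNReal.ofReal s * rearr f s ≤ N :=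
    ae_restrict_of_ae_restrict_of_subset (fun s hs => lt_trans (half_pos ht) hs.1) h1
  have : (ae (volume.restrict (Ioo (t / 2) t))).NeBot := by
    rw [ae_neBot, Ne, Measure.restrict_eq_zero, Real.volume_Ioo]
    simpa using half_lt_self ht
  obtain ⟨s, hs, hst⟩ := (h2.and (ae_restrict_mem measurableSet_Ioo)).exists
  calc ENNReal.ofReal t * rearr f t ≤ 2 * ENNReal.ofReal s * rearr f s := by
        refine mul_le_mul' ?_ (rearr_antitone f hst.2.le)
        rw [show (2 : ℝ≥0∞) = ENNReal.ofReal 2 by simp, ← ENNReal.ofReal_mul (by norm_num)]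
        exact ENNReal.ofReal_le_ofReal (by linarith [hst.1])
    _ ≤ 2 * N := by rw [mul_assoc]; exact mul_le_mul_right hs _

theorem lebesgue_one_carrier_subset : (lebesgue μ 𝕜 1).carrier ⊆ (lorentz μ 𝕜 1 ∞).carrier :=
  fun f hf => lt_of_le_of_lt (lorentz_one_top_qnorm_le f) hf

theorem K_lorentz_le_K_lebesgue (t : ℝ) (f : Ω →ₘ[μ] 𝕜) :
    QSpace.K (lorentz μ 𝕜 1 ∞) (lebesgue μ 𝕜 ∞) t f ≤
      QSpace.K (lebesgue μ 𝕜 1) (lebesgue μ 𝕜 ∞) t f :=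
  le_iInf₂ fun f₀ h₀ => le_iInf₂ fun f₁ h₁ => le_iInf fun h =>
    (iInf₂_le_of_le f₀ (lebesgue_one_carrier_subset h₀) <| iInf₂_le_of_le f₁ h₁ <|
      iInf_le_of_le h le_rfl).trans (add_le_add_left (lorentz_one_top_qnorm_le f₀) _)

theorem ofReal_mul_rearr_le_K (f : Ω →ₘ[μ] 𝕜) {t : ℝ} (ht : 0 < t) :
    ENNReal.ofReal t * rearr f t ≤ 2 * QSpace.K (lorentz μ 𝕜 1 ∞) (lebesgue μ 𝕜 ∞) t f := by
  rw [mul_comm 2, ← ENNReal.div_le_iff_le_mul (.inl (by simp)) (.inl (by simp))]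
  refine le_iInf₂ fun f₀ _ => le_iInf₂ fun f₁ _ => le_iInf fun h => ?_
  rw [ENNReal.div_le_iff_le_mul (.inl (by simp)) (.inl (by simp)), h, mul_comm _ 2, mul_add]
  refine (mul_le_mul_right (rearr_add_le f₀ f₁ t) _).trans ?_
  rw [mul_add]
  refine add_le_add (ofReal_mul_rearr_le_lorentz f₀ ht) ?_
  exact le_mul_of_one_le_left zero_le (by norm_num)

theorem ofReal_mul_maxRearr (f : Ω →ₘ[μ] 𝕜) {t : ℝ} (ht : 0 < t) :
    ENNReal.ofReal t * maxRearr f t = ∫⁻ u in Ioo 0 t, rearr f u :=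
  ENNReal.mul_div_cancel (by simpa using ht) ENNReal.ofReal_ne_top

theorem exists_mem_decomposition {f : Ω →ₘ[μ] 𝕜} {t : ℝ} (ht : 0 < t)
    (hf : ∫⁻ u in Ioo 0 t, rearr f u ≠ ∞) :
    ∃ f₀ ∈ (lebesgue μ 𝕜 1).carrier, ∃ f₁ ∈ (lebesgue μ 𝕜 ∞).carrier, f = f₀ + f₁ ∧
      eLpNorm f₀ 1 μ ≤ ∫⁻ u in Ioo 0 t, rearr f u ∧ eLpNorm f₁ ∞ μ ≤ rearr f t := by
  obtain ⟨f₀, f₁, h, h₀, h₁⟩ := exists_decomposition f t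
  refine ⟨f₀, lt_of_le_of_lt h₀ hf.lt_top, f₁, lt_of_le_of_lt h₁ ?_, h, h₀, h₁⟩
  -- `f^*(t) = ∞` would force `∫₀ᵗ f^* ≥ t f^*(t) = ∞`.
  refine lt_top_iff_ne_top.2 fun htop => hf (top_le_iff.1 ?_)
  have := ofReal_mul_rearr_le_lintegral f t
  rwa [htop, ENNReal.mul_top (by simpa using ht)] at this

theorem K_lebesgue_le (f : Ω →ₘ[μ] 𝕜) {t : ℝ} (ht : 0 < t) :
    QSpace.K (lebesgue μ 𝕜 1) (lebesgue μ 𝕜 ∞) t f ≤ 2 * (ENNReal.ofReal t * maxRearr f t) := by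
  rw [ofReal_mul_maxRearr f ht]
  by_cases hf : ∫⁻ u in Ioo 0 t, rearr f u = ∞
  · simp [hf]
  obtain ⟨f₀, m₀, f₁, m₁, h, h₀, h₁⟩ := exists_mem_decomposition ht hf
  refine iInf₂_le_of_le f₀ m₀ <| iInf₂_le_of_le f₁ m₁ <| iInf_le_of_le h ?_
  -- Both `‖f₀‖₁` and `t ‖f₁‖_∞ ≤ t f^*(t)` are at most `∫₀ᵗ f^*`.
  rw [two_mul]
  exact add_le_add h₀ ((mul_le_mul_right h₁ _).trans (ofReal_mul_rearr_le_lintegral f t))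

end rearr

/-! ### The cycle of embeddings. -/

section interpolation

variable {Ω : Type*} [MeasurableSpace Ω] (μ : Measure Ω) (𝕜 : Type*) [RCLike 𝕜]
  {θ : ℝ} {r q : ℝ≥0∞} {a b : ℝ → ℝ}

theorem starR_le_limitingR_lorentz (f : Ω →ₘ[μ] 𝕜) :
    rNorm (1 - θ) r b q a (rearr f) ≤
      2 * rNorm (-θ) r b q a fun u => QSpace.K (lorentz μ 𝕜 1 ∞) (lebesgue μ 𝕜 ∞) u f := by
  rw [sub_eq_add_neg, add_comm, ← rNorm_mul_id]
  exact rNorm_le_mul (by simp) fun u hu => ofReal_mul_rearr_le_K f hu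

theorem limitingR_lebesgue_le_maxR (f : Ω →ₘ[μ] 𝕜) :
    (rNorm (-θ) r b q a fun u => QSpace.K (lebesgue μ 𝕜 1) (lebesgue μ 𝕜 ∞) u f) ≤
      2 * rNorm (1 - θ) r b q a (maxRearr f) := by
  rw [sub_eq_add_neg, add_comm 1, ← rNorm_mul_id]
  exact rNorm_le_mul (by simp) fun u hu => K_lebesgue_le f hu

theorem limitingR_lebesgue_embeds :
    (QSpace.limitingR (lebesgue μ 𝕜 1) (lebesgue μ 𝕜 ∞) θ r b q a).Embeds
      (QSpace.limitingR (lorentz μ 𝕜 1 ∞) (lebesgue μ 𝕜 ∞) θ r b q a) := by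
  have h (f : Ω →ₘ[μ] 𝕜) := rNorm_mono (α := -θ) (r := r) (b := b) (q := q) (a := a)
    fun u _ => K_lorentz_le_K_lebesgue u f
  refine ⟨fun f hf => ⟨?_, (h f).trans_lt hf.2⟩, 1,
    fun f _ => (h f).trans (by simp [QSpace.limitingR])⟩
  obtain ⟨f₀, h₀, f₁, h₁, e⟩ := hf.1
  exact ⟨f₀, lebesgue_one_carrier_subset h₀, f₁, h₁, e⟩

theorem limitingR_lorentz_embeds {p : ℝ≥0∞} (hp : recip p = 1 - θ) :
    (QSpace.limitingR (lorentz μ 𝕜 1 ∞) (lebesgue μ 𝕜 ∞) θ r b q a).Embeds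
      (starR μ 𝕜 p r b q a) := by
  have h : ∀ f, (starR μ 𝕜 p r b q a).qnorm f ≤ ((2 : ℝ≥0) : ℝ≥0∞) *
      (QSpace.limitingR (lorentz μ 𝕜 1 ∞) (lebesgue μ 𝕜 ∞) θ r b q a).qnorm f := fun f => by
    change rNorm (recip p) r b q a (rearr f) ≤ _
    rw [hp]
    exact starR_le_limitingR_lorentz μ 𝕜 f
  exact ⟨fun f hf => (h f).trans_lt (ENNReal.mul_lt_top (by simp) hf.2), 2, fun f _ => h f⟩

theorem starR_embeds_maxR {p : ℝ≥0∞} (hp : recip p = 1 - θ) (hθ : 0 < θ)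
    (ha : IsSlowlyVarying a) (hb : IsSlowlyVarying b) :
    (starR μ 𝕜 p r b q a).Embeds (maxR μ 𝕜 p r b q a) := by
  obtain ⟨C, hC⟩ := exists_rNorm_mean_le (α := recip p) (by linarith) r q ha hb
  have h : ∀ f, (maxR μ 𝕜 p r b q a).qnorm f ≤ C * (starR μ 𝕜 p r b q a).qnorm f := fun f =>
    hC _ (rearr_antitone f)
  exact ⟨fun f hf => (h f).trans_lt (ENNReal.mul_lt_top (by simp) hf), C, fun f _ => h f⟩

theorem maxR_embeds_limitingR {p : ℝ≥0∞} (hp : recip p = 1 - θ) (hq : 0 < q) (hr : 0 < r)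
    (ha : IsSlowlyVarying a) (hb : IsSlowlyVarying b) :
    (maxR μ 𝕜 p r b q a).Embeds
      (QSpace.limitingR (lebesgue μ 𝕜 1) (lebesgue μ 𝕜 ∞) θ r b q a) := by
  have h : ∀ f, (QSpace.limitingR (lebesgue μ 𝕜 1) (lebesgue μ 𝕜 ∞) θ r b q a).qnorm f ≤
      ((2 : ℝ≥0) : ℝ≥0∞) * (maxR μ 𝕜 p r b q a).qnorm f := fun f => by
    change _ ≤ _ * rNorm (recip p) r b q a (maxRearr f)
    rw [hp]
    exact limitingR_lebesgue_le_maxR μ 𝕜 f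
  refine ⟨fun f hf => ⟨?_, (h f).trans_lt (ENNReal.mul_lt_top (by simp) hf)⟩, 2, fun f _ => h f⟩
  obtain ⟨t, ht, hlt⟩ := exists_lt_top_of_rNorm_lt_top hq hr ha hb hf
  have hfin : ∫⁻ u in Ioo 0 t, rearr f u ≠ ∞ := by
    rw [← ofReal_mul_maxRearr f ht]
    exact ENNReal.mul_ne_top ENNReal.ofReal_ne_top hlt.ne
  obtain ⟨f₀, m₀, f₁, m₁, e, -⟩ := exists_mem_decomposition ht hfin
  exact ⟨f₀, m₀, f₁, m₁, e⟩

end interpolation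

theorem QSpace.Embeds.trans {M : Type*} {X Y Z : QSpace M} (h : X.Embeds Y) (h' : Y.Embeds Z) :
    X.Embeds Z := by
  obtain ⟨hs, C, hC⟩ := h
  obtain ⟨hs', C', hC'⟩ := h'
  refine ⟨hs.trans hs', C' * C, fun f hf => (hC' f (hs hf)).trans ?_⟩
  rw [ENNReal.coe_mul, mul_assoc]
  exact mul_le_mul_right (hC f hf) _

theorem limitingR_identical {Ω : Type*} [MeasurableSpace Ω] (μ : Measure Ω) (𝕜 : Type*)
    [RCLike 𝕜] {θ : ℝ} (hθ : 0 < θ) {p q r : ℝ≥0∞} (hp : recip p = 1 - θ) (hq : 0 < q)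
    (hr : 0 < r) {a b : ℝ → ℝ} (ha : IsSlowlyVarying a) (hb : IsSlowlyVarying b) :
    (QSpace.limitingR (lebesgue μ 𝕜 1) (lebesgue μ 𝕜 ∞) θ r b q a).Identical
        (QSpace.limitingR (lorentz μ 𝕜 1 ∞) (lebesgue μ 𝕜 ∞) θ r b q a) ∧
      (QSpace.limitingR (lorentz μ 𝕜 1 ∞) (lebesgue μ 𝕜 ∞) θ r b q a).Identical
        (maxR μ 𝕜 p r b q a) ∧
      (maxR μ 𝕜 p r b q a).Identical (starR μ 𝕜 p r b q a) := by
  have h₁ := limitingR_lebesgue_embeds μ 𝕜 (θ := θ) (r := r) (b := b) (q := q) (a := a)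
  have h₂ := limitingR_lorentz_embeds μ 𝕜 (r := r) (b := b) (q := q) (a := a) hp
  have h₃ := starR_embeds_maxR μ 𝕜 (r := r) (q := q) hp hθ ha hb
  have h₄ := maxR_embeds_limitingR μ 𝕜 hp hq hr ha hb
  exact ⟨⟨h₁, h₂.trans (h₃.trans h₄)⟩, ⟨h₂.trans h₃, h₄.trans h₁⟩, ⟨h₄.trans (h₁.trans h₂), h₃⟩⟩

theorem grandStar_eq_starR {Ω : Type*} [MeasurableSpace Ω] (μ : Measure Ω) (𝕜 : Type*)
    [RCLike 𝕜] (p q r : ℝ≥0∞) (b : ℝ → ℝ) :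
    grandStar μ 𝕜 p q r b = starR μ 𝕜 p r b q fun _ => 1 := by
  simp [grandStar, starR, rNorm, weight]

theorem grandMax_eq_maxR {Ω : Type*} [MeasurableSpace Ω] (μ : Measure Ω) (𝕜 : Type*)
    [RCLike 𝕜] (p q r : ℝ≥0∞) (b : ℝ → ℝ) :
    grandMax μ 𝕜 p q r b = maxR μ 𝕜 p r b q fun _ => 1 := by
  simp [grandMax, maxR, rNorm, weight]

end LorentzKaramata

open LorentzKaramata in
theorem theorem6p4 {Ω : Type*} [MeasurableSpace Ω] (μ : Measure Ω) [SigmaFinite μ]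
    (hμ : IsNonatomic μ) (𝕜 : Type*) [RCLike 𝕜]
    (θ : ℝ) (hθ0 : 0 < θ) (hθ1 : θ ≤ 1)
    (p : ℝ≥0∞) (hp : p = 1 / ENNReal.ofReal (1 - θ))
    (q r : ℝ≥0∞) (hq : 0 < q) (hr : 0 < r)
    (a b : ℝ → ℝ) (ha : IsSlowlyVarying a) (hb : IsSlowlyVarying b) :
    ((QSpace.limitingR (lebesgue μ 𝕜 1) (lebesgue μ 𝕜 ∞) θ r b q a).Identical
        (QSpace.limitingR (lorentz μ 𝕜 1 ∞) (lebesgue μ 𝕜 ∞) θ r b q a) ∧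
      (QSpace.limitingR (lorentz μ 𝕜 1 ∞) (lebesgue μ 𝕜 ∞) θ r b q a).Identical
        (maxR μ 𝕜 p r b q a) ∧
      (maxR μ 𝕜 p r b q a).Identical (starR μ 𝕜 p r b q a)) ∧
    ((QSpace.limitingR (lebesgue μ 𝕜 1) (lebesgue μ 𝕜 ∞) θ r b q fun _ => 1).Identical
        (QSpace.limitingR (lorentz μ 𝕜 1 ∞) (lebesgue μ 𝕜 ∞) θ r b q fun _ => 1) ∧
      (QSpace.limitingR (lorentz μ 𝕜 1 ∞) (lebesgue μ 𝕜 ∞) θ r b q fun _ => 1).Identical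
        (grandMax μ 𝕜 p q r b) ∧
      (grandMax μ 𝕜 p q r b).Identical (grandStar μ 𝕜 p q r b)) := by
  -- This covers `θ = 1` too: there `p = 1 / 0 = ∞` in `ℝ≥0∞`, and its reciprocal is `0`.
  have hp' : recip p = 1 - θ := by
    rw [hp, recip, one_div, inv_inv, ENNReal.toReal_ofReal (by linarith)]
  rw [grandStar_eq_starR, grandMax_eq_maxR]
  exact ⟨limitingR_identical μ 𝕜 hθ0 hp' hq hr ha hb,
    limitingR_identical μ 𝕜 hθ0 hp' hq hr isSlowlyVarying_one hb⟩
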